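/- Let $p\ge 0$ be fixed, $\beta^*\in\mathbb{R}^p$, $S=\{j:\beta^*_j\neq 0\}$. For every $n$ let $y=X\beta^*+\varepsilon$ with a deterministic design matrix $X=X_n\in\mathbb{R}^{n\times p}$ with rows $x_1,\dots,x_n$ and noise $\varepsilon=\varepsilon_n\in\mathbb{R}^n$ with i.i.d. $\mathcal N(0,\sigma^2)$ entries, and assume that, as $n\to\infty$, $\frac1n X^\top X\to C$ for a positive definite matrix $C$ and $\frac1n\max_i\|x_i\|_2^2\to 0$. Let $m=m_n$ be integers, positive for all large $n$, with $n/m\to r_0\in[0,\infty)$, and let $\tilde\beta=\tilde\beta_n$ be an $\mathbb{R}^p$-valued random vector (the initial estimator), independent of $\varepsilon_n$, such that $\sqrt m(\tilde\beta-\beta^*)$ converges in distribution to some random vector $z$. Let $\gamma_1,\gamma_2\ge 0$, $\lambda_n,\eta_n\ge 0$, and let the Adaptive Transfer Lasso estimator $\hat\beta=\hat\beta_n$ be a random vector that almost surely minimizes over $\beta\in\mathbb{R}^p$ $$\frac1n\|y-X\beta\|_2^2+\frac{\lambda_n}{n}\sum_j\frac{|\beta_j|}{|\tilde\beta_j|^{\gamma_1}}+\frac{\eta_n}{n}\sum_j|\tilde\beta_j|^{\gamma_2}\,|\beta_j-\tilde\beta_j|,$$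 where $0^0=1$ and, if $\gamma_1>0$, $1/0^{\gamma_1}=\infty$ with $0\cdot\infty=0$ (so, when $\lambda_n>0$, a coordinate with $\tilde\beta_j=0$ is forced to be $0$). Put $\hat S=\{j:\hat\beta_j\ne 0\}$. Suppose that, as $n\to\infty$, $$\sqrt{m^{\gamma_1}/n}\;\lambda_n\to\infty,\qquad \frac{\eta_n}{\sqrt n}\to\infty,\qquad \frac{\eta_n}{\lambda_n}\to\infty,\qquad \frac{\eta_n}{\sqrt{m^{\gamma_1+\gamma_2}}\,\lambda_n}\to 0 .$$ Then the following three properties hold: 1. ($\sqrt m$-consistency) $\sqrt m(\hat\beta-\beta^*)$ converges in distribution, namely to the random vector whose $j$-th coordinate is $z_j$ for $j\in S$ and $0$ for $j\notin S$; 2. (consistent active variable selection) $P(\hat S=S)\to 1$; 3. (consistent invariant variable selection) $P(\hat\beta_S=\tilde\beta_S)\to 1$. -/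

import Mathlib

open MeasureTheory ProbabilityTheory Filter Topology
open scoped ENNReal NNReal Matrix

/-- Response vector `y = X β + e` of the linear model with `n` observations and `p` regressors. -/
def linearResponse {n p : ℕ} (X : Matrix (Fin n) (Fin p) ℝ) (β : Fin p → ℝ) (e : Fin n → ℝ) :
    Fin n → ℝ :=
  X *ᵥ β + e

/-- Objective function of the Adaptive Transfer Lasso with initial estimate `b` (playing the role
of `β̃`), at the candidate `β`:
`(1/n) ‖y - Xβ‖₂² + (lam/n) ∑ⱼ vⱼ |βⱼ| + (eta/n) ∑ⱼ wⱼ |βⱼ - bⱼ|`,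
where `vⱼ = 1 / |bⱼ|^γ₁` and `wⱼ = |bⱼ|^γ₂`.
It takes values in `[0, ∞]`: if `bⱼ = 0` and `γ₁ > 0`, then `vⱼ = ∞`, and (as `∞ * 0 = 0`) an
infinite weight forces `βⱼ = 0` as soon as `lam > 0`. Powers with exponent `0` are `1`. -/
noncomputable def adaptiveTransferLassoObjective {n p : ℕ} (X : Matrix (Fin n) (Fin p) ℝ)
    (y : Fin n → ℝ) (lam eta γ₁ γ₂ : ℝ) (b β : Fin p → ℝ) : ℝ≥0∞ :=
  ENNReal.ofReal ((1 / n) * ∑ i, (y i - (X *ᵥ β) i) ^ 2)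
    + ENNReal.ofReal (lam / n) *
        ∑ j, (1 / ENNReal.ofReal |b j| ^ γ₁) * ENNReal.ofReal |β j|
    + ENNReal.ofReal (eta / n) *
        ∑ j, ENNReal.ofReal |b j| ^ γ₂ * ENNReal.ofReal |β j - b j|

/-- `β` is an Adaptive Transfer Lasso estimate, i.e. a global minimizer of the objective. -/
def IsAdaptiveTransferLasso {n p : ℕ} (X : Matrix (Fin n) (Fin p) ℝ)
    (y : Fin n → ℝ) (lam eta γ₁ γ₂ : ℝ) (b β : Fin p → ℝ) : Prop :=
  ∀ β' : Fin p → ℝ, adaptiveTransferLassoObjective X y lam eta γ₁ γ₂ b β ≤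
    adaptiveTransferLassoObjective X y lam eta γ₁ γ₂ b β'

/-! With probability tending to one, `βhat` equals the candidate `c = S.indicator βtilde`; all three
claims follow from this. At `c` each coordinate sits at a kink: of the transfer penalty on `S`, of
the adaptive penalty off `S`. By convexity `c` is the unique minimizer as soon as the gap between
the two penalty weights strictly exceeds the score there (`IsAdaptiveTransferLasso.eq_indicator`).
Tightness gives `βtilde - βstar = O(1/√m)` and `Xᵀε = O(√n)`, so the score at `c` is `O(√n + n/√m) =
O(√n)`, as `n/m` is bounded. On `S` the powers of `|βtilde j|` are bounded above and away from zero,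
and `h2`, `h3` make `eta` dominate. Off `S` the adaptive weight is at least of order `m^(γ₁/2)` and
the transfer weight at most of order `m^(-γ₂/2)`, so `h1`, `h4` make `lam` dominate. -/

/-! ### Finite and infinite values of the objective. -/

/-- The Adaptive Transfer Lasso objective multiplied by `n`, as a real number. It agrees with
`adaptiveTransferLassoObjective` at the candidates where the latter is finite. -/
noncomputable def scaledTransferLassoObjective {n p : ℕ} (X : Matrix (Fin n) (Fin p) ℝ)
    (y : Fin n → ℝ) (lam eta γ₁ γ₂ : ℝ) (b β : Fin p → ℝ) : ℝ :=
  ∑ i, (y i - (X *ᵥ β) i) ^ 2 +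
    ∑ j, (lam * (|b j| ^ γ₁)⁻¹ * |β j| + eta * |b j| ^ γ₂ * |β j - b j|)

/-- The side condition excludes the only conflict: at `b = 0`, `γ ≠ 0` the real inverse is `0` but
the extended one is `⊤`. -/
lemma one_div_ofReal_rpow_mul_ofReal {γ b x : ℝ} (hγ : 0 ≤ γ)
    (h : b = 0 → γ ≠ 0 → x = 0) :
    (1 / ENNReal.ofReal |b| ^ γ) * ENNReal.ofReal |x| =
      ENNReal.ofReal ((|b| ^ γ)⁻¹ * |x|) := by
  by_cases hx : x = 0
  · simp [hx]
  have hpos : 0 < |b| ^ γ := by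
    rcases eq_or_ne γ 0 with rfl | hγ0
    · simp
    · exact Real.rpow_pos_of_pos (abs_pos.2 fun hb => hx (h hb hγ0)) _
  rw [ENNReal.ofReal_rpow_of_nonneg (abs_nonneg _) hγ, ENNReal.ofReal_mul (by positivity),
    ENNReal.ofReal_inv_of_pos hpos, one_div]

lemma adaptiveTransferLassoObjective_eq_ofReal {n p : ℕ} (X : Matrix (Fin n) (Fin p) ℝ)
    (y : Fin n → ℝ) {lam eta γ₁ γ₂ : ℝ} (hlam : 0 ≤ lam) (heta : 0 ≤ eta)
    (hγ₁ : 0 ≤ γ₁) (hγ₂ : 0 ≤ γ₂) {b β : Fin p → ℝ}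
    (h : ∀ j, b j = 0 → γ₁ ≠ 0 → β j = 0) :
    adaptiveTransferLassoObjective X y lam eta γ₁ γ₂ b β =
      ENNReal.ofReal ((1 / n) * scaledTransferLassoObjective X y lam eta γ₁ γ₂ b β) := by
  unfold adaptiveTransferLassoObjective scaledTransferLassoObjective
  have e1 : ∀ j, (1 / ENNReal.ofReal |b j| ^ γ₁) * ENNReal.ofReal |β j| =
      ENNReal.ofReal ((|b j| ^ γ₁)⁻¹ * |β j|) := fun j =>
    one_div_ofReal_rpow_mul_ofReal hγ₁ (h j)
  have e2 : ∀ j, ENNReal.ofReal |b j| ^ γ₂ * ENNReal.ofReal |β j - b j| =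
      ENNReal.ofReal (|b j| ^ γ₂ * |β j - b j|) := fun j => by
    rw [ENNReal.ofReal_rpow_of_nonneg (abs_nonneg _) hγ₂, ENNReal.ofReal_mul (by positivity)]
  simp_rw [e1, e2]
  rw [← ENNReal.ofReal_sum_of_nonneg (fun _ _ => by positivity),
    ← ENNReal.ofReal_sum_of_nonneg (fun _ _ => by positivity),
    ← ENNReal.ofReal_mul (by positivity), ← ENNReal.ofReal_mul (by positivity),
    ← ENNReal.ofReal_add (by positivity) (by positivity),
    ← ENNReal.ofReal_add (by positivity) (by positivity)]
  congr 1
  rw [Finset.sum_add_distrib]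
  simp only [mul_assoc, ← Finset.mul_sum]
  ring

lemma adaptiveTransferLassoObjective_eq_top {n p : ℕ} (X : Matrix (Fin n) (Fin p) ℝ)
    (y : Fin n → ℝ) {lam eta γ₁ γ₂ : ℝ} (hn : 0 < n) (hlam : 0 < lam)
    (hγ₁ : 0 < γ₁) {b β : Fin p → ℝ} {j : Fin p} (hb : b j = 0) (hβ : β j ≠ 0) :
    adaptiveTransferLassoObjective X y lam eta γ₁ γ₂ b β = ⊤ := by
  have hn' : (0 : ℝ) < n := by exact_mod_cast hn
  have hterm : (1 / ENNReal.ofReal |b j| ^ γ₁) * ENNReal.ofReal |β j| = ⊤ := by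
    simp [hb, hγ₁, ENNReal.top_mul, hβ]
  have hsum : ∑ j, (1 / ENNReal.ofReal |b j| ^ γ₁) * ENNReal.ofReal |β j| = ⊤ :=
    ENNReal.sum_eq_top.2 ⟨j, Finset.mem_univ _, hterm⟩
  unfold adaptiveTransferLassoObjective
  rw [hsum, ENNReal.mul_top (by simpa using div_pos hlam hn')]
  simp

/-! ### Deterministic optimality criterion. -/

/-- Expand the square around `c`, drop `‖X(β - c)‖²`, and bound the linear term coordinatewise so
that it can be compared with the separable penalty. -/
lemma sum_sq_sub_mulVec_add_sub_le {n p : ℕ} (X : Matrix (Fin n) (Fin p) ℝ)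
    (y : Fin n → ℝ) (c β : Fin p → ℝ) :
    ∑ i, (y i - (X *ᵥ c) i) ^ 2 - ∑ j, 2 * |(Xᵀ *ᵥ (y - X *ᵥ c)) j| * |β j - c j| ≤
      ∑ i, (y i - (X *ᵥ β) i) ^ 2 := by
  have hcross : ∑ i, (y i - (X *ᵥ c) i) * (X *ᵥ (β - c)) i =
      ∑ j, (Xᵀ *ᵥ (y - X *ᵥ c)) j * (β j - c j) := by
    have := Matrix.dotProduct_mulVec (y - X *ᵥ c) X (β - c)
    rw [← Matrix.mulVec_transpose] at this
    simpa [dotProduct] using this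
  have hle : ∑ j, (Xᵀ *ᵥ (y - X *ᵥ c)) j * (β j - c j) ≤
      ∑ j, |(Xᵀ *ᵥ (y - X *ᵥ c)) j| * |β j - c j| :=
    Finset.sum_le_sum fun j _ => by rw [← abs_mul]; exact le_abs_self _
  have hsq : ∑ i, (y i - (X *ᵥ β) i) ^ 2 = ∑ i, (y i - (X *ᵥ c) i) ^ 2 -
      2 * ∑ i, (y i - (X *ᵥ c) i) * (X *ᵥ (β - c)) i + ∑ i, (X *ᵥ (β - c)) i ^ 2 := by
    rw [Finset.mul_sum, ← Finset.sum_sub_distrib, ← Finset.sum_add_distrib]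
    refine Finset.sum_congr rfl fun i _ => ?_
    rw [Matrix.mulVec_sub, Pi.sub_apply]
    ring
  have hnn : 0 ≤ ∑ i, (X *ᵥ (β - c)) i ^ 2 := Finset.sum_nonneg fun _ _ => sq_nonneg _
  rw [hsq, hcross]
  simp only [mul_assoc, ← Finset.mul_sum]
  linarith

/-- A first-order criterion: if on `S` the transfer weights dominate, and off `S` the adaptive
weights dominate, then the only minimizer equals `b` on `S` and vanishes off `S`. -/
theorem IsAdaptiveTransferLasso.eq_indicator {n p : ℕ} {X : Matrix (Fin n) (Fin p) ℝ}
    {y : Fin n → ℝ} {lam eta γ₁ γ₂ : ℝ} (hn : 0 < n) (hlam : 0 < lam) (heta : 0 ≤ eta)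
    (hγ₁ : 0 ≤ γ₁) (hγ₂ : 0 ≤ γ₂) {b β : Fin p → ℝ} {S : Set (Fin p)}
    (hβ : IsAdaptiveTransferLasso X y lam eta γ₁ γ₂ b β)
    (hbS : ∀ j ∈ S, b j ≠ 0)
    (hS : ∀ j ∈ S, 2 * |(Xᵀ *ᵥ (y - X *ᵥ S.indicator b)) j| <
      eta * |b j| ^ γ₂ - lam * (|b j| ^ γ₁)⁻¹)
    (hSc : ∀ j ∉ S, (b j = 0 → γ₁ = 0) → 2 * |(Xᵀ *ᵥ (y - X *ᵥ S.indicator b)) j| <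
      lam * (|b j| ^ γ₁)⁻¹ - eta * |b j| ^ γ₂) :
    β = S.indicator b := by
  classical
  set c := S.indicator b with hc
  have hn' : (0 : ℝ) < n := by exact_mod_cast hn
  have hcfin : ∀ j, b j = 0 → γ₁ ≠ 0 → c j = 0 := fun j hj _ => by
    by_cases hjS : j ∈ S
    · exact absurd hj (hbS j hjS)
    · simp [hc, hjS]
  have hobjc := adaptiveTransferLassoObjective_eq_ofReal X y hlam.le heta hγ₁ hγ₂ hcfin
  -- Otherwise the objective at `β` is infinite, while at `c` it is finite.
  have hβfin : ∀ j, b j = 0 → γ₁ ≠ 0 → β j = 0 := fun j hj hγ => by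
    by_contra hne
    have htop := adaptiveTransferLassoObjective_eq_top X y (eta := eta) (γ₂ := γ₂) hn hlam
      (lt_of_le_of_ne hγ₁ (Ne.symm hγ)) hj hne
    have := hβ c
    rw [htop, hobjc] at this
    exact absurd this (not_le.2 ENNReal.ofReal_lt_top)
  have hle := hβ c
  have hcnn : 0 ≤ scaledTransferLassoObjective X y lam eta γ₁ γ₂ b c := by
    unfold scaledTransferLassoObjective; positivity
  rw [hobjc, adaptiveTransferLassoObjective_eq_ofReal X y hlam.le heta hγ₁ hγ₂ hβfin,
    ENNReal.ofReal_le_ofReal_iff (by positivity)] at hle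
  have hle' := le_of_mul_le_mul_left hle (by positivity)
  unfold scaledTransferLassoObjective at hle'
  have hquad := sum_sq_sub_mulVec_add_sub_le X y c β
  set g : Fin p → ℝ := fun j => (Xᵀ *ᵥ (y - X *ᵥ c)) j with hg
  -- `D j` is the penalty increase from `c` to `β` at `j` minus the largest possible linear gain;
  -- minimality makes the sum nonpositive.
  set D : Fin p → ℝ := fun j =>
    (lam * (|b j| ^ γ₁)⁻¹ * |β j| + eta * |b j| ^ γ₂ * |β j - b j|) -
    (lam * (|b j| ^ γ₁)⁻¹ * |c j| + eta * |b j| ^ γ₂ * |c j - b j|) -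
    2 * |g j| * |β j - c j| with hD
  have hDsum : ∑ j, D j ≤ 0 := by
    simp only [hD, Finset.sum_sub_distrib]
    linarith
  have hDpos : ∀ j, 0 ≤ D j ∧ (β j ≠ c j → 0 < D j) := by
    intro j
    have hv : 0 ≤ lam * (|b j| ^ γ₁)⁻¹ := by positivity
    have hw : 0 ≤ eta * |b j| ^ γ₂ := by positivity
    suffices h : β j ≠ c j → 0 < D j by
      refine ⟨?_, h⟩
      by_cases hj : β j = c j
      · simp [hD, hj]
      · exact (h hj).le
    intro hj
    have hu : 0 < |β j - c j| := abs_pos.2 (sub_ne_zero.2 hj)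
    by_cases hjS : j ∈ S
    · have hcj : c j = b j := by simp [hc, hjS]
      have h1 := hS j hjS
      have h2 : |c j| - |β j| ≤ |β j - c j| := by
        rw [abs_sub_comm]; exact abs_sub_abs_le_abs_sub _ _
      have h3 := mul_le_mul_of_nonneg_left h2 hv
      have h4 := mul_lt_mul_of_pos_right h1 hu
      simp only [hD, hg]
      rw [hcj] at h3 h4 ⊢
      simp only [sub_self, abs_zero]
      linarith
    · have hcj : c j = 0 := by simp [hc, hjS]
      -- The infinite-weight case cannot occur here: it would force `β j = 0 = c j`.
      have h1 := hSc j hjS (fun hb => by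
        by_contra hγ; exact hj (by rw [hβfin j hb hγ, hcj]))
      have h2 : |b j| - |β j - b j| ≤ |β j| := by
        have := abs_sub_abs_le_abs_sub (b j) (b j - β j)
        rw [abs_sub_comm (b j)] at this
        simpa using this
      have h3 := mul_le_mul_of_nonneg_left h2 hw
      have h4 := mul_lt_mul_of_pos_right h1 hu
      simp only [hD, hg]
      rw [hcj] at h4 ⊢
      simp only [sub_zero, zero_sub, abs_zero, abs_neg] at h4 ⊢
      linarith
  funext j
  by_contra hj
  exact absurd hDsum (not_le.2 (Finset.sum_pos' (fun j _ => (hDpos j).1)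
    ⟨j, Finset.mem_univ _, (hDpos j).2 hj⟩))

/-! ### Asymptotic size of the weights and of the score. -/

lemma tendsto_natCast_atTop_of_tendsto_div {m : ℕ → ℕ} (hm : ∀ᶠ n in atTop, 0 < m n) {r : ℝ}
    (hr : Tendsto (fun n : ℕ => (n : ℝ) / (m n : ℝ)) atTop (𝓝 r)) :
    Tendsto (fun n => (m n : ℝ)) atTop atTop := by
  have hpos : 0 < |r| + 1 := by positivity
  refine tendsto_atTop_mono' _ ?_
    ((tendsto_natCast_atTop_atTop (R := ℝ)).atTop_div_const hpos)
  filter_upwards [hm, hr.eventually (gt_mem_nhds (lt_of_le_of_lt (le_abs_self r)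
    (lt_add_one _)))] with n hmn hn
  have hmn' : (0 : ℝ) < m n := by exact_mod_cast hmn
  rw [div_le_iff₀ hpos]
  rw [div_lt_iff₀ hmn'] at hn
  linarith

/-- Since `eta / 0 = 0`, divergence of the ratio already rules out `lam n = 0`. -/
lemma eventually_pos_of_tendsto_div_atTop {lam eta : ℕ → ℝ} (hlam : ∀ n, 0 ≤ lam n)
    (h : Tendsto (fun n : ℕ => eta n / lam n) atTop atTop) : ∀ᶠ n in atTop, 0 < lam n := by
  filter_upwards [h.eventually (eventually_gt_atTop 0)] with n hn
  refine lt_of_le_of_ne (hlam n) fun h0 => ?_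
  simp [← h0] at hn

/-- On an active coordinate the transfer penalty eventually dominates, uniformly over initial
estimates at distance `O(1/√m)` of the true value. -/
lemma eventually_transfer_weight_dominates {m : ℕ → ℕ}
    (hm : Tendsto (fun n => (m n : ℝ)) atTop atTop)
    {γ₁ γ₂ : ℝ} (hγ₁ : 0 ≤ γ₁) (hγ₂ : 0 ≤ γ₂) {lam eta : ℕ → ℝ} (hlam : ∀ n, 0 ≤ lam n)
    (heta : ∀ n, 0 ≤ eta n)
    (h2 : Tendsto (fun n : ℕ => eta n / √(n : ℝ)) atTop atTop)
    (h3 : Tendsto (fun n : ℕ => eta n / lam n) atTop atTop)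
    {c : ℝ} (hc : c ≠ 0) (K M : ℝ) :
    ∀ᶠ n in atTop, ∀ x : ℝ, |x - c| ≤ K / √(m n : ℝ) →
      x ≠ 0 ∧ 2 * (M * √(n : ℝ)) < eta n * |x| ^ γ₂ - lam n * (|x| ^ γ₁)⁻¹ := by
  have hc2 : 0 < |c| / 2 := by positivity
  set A := (|c| / 2) ^ γ₂ with hA
  set B := ((|c| / 2) ^ γ₁)⁻¹ with hB
  have hApos : 0 < A := Real.rpow_pos_of_pos hc2 _
  have hK : Tendsto (fun n => K / √(m n : ℝ)) atTop (𝓝 0) :=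
    (Real.tendsto_sqrt_atTop.comp hm).const_div_atTop K
  -- The two thresholds make `lam * B` and `2 * M * √n` each at most half of `eta * A`.
  filter_upwards [hK.eventually (gt_mem_nhds hc2), eventually_pos_of_tendsto_div_atTop hlam h3,
    h3.eventually (eventually_ge_atTop (2 * B / A)),
    h2.eventually (eventually_gt_atTop (4 * M / A)), eventually_gt_atTop 0]
    with n hKn hl hel hen hn x hx
  have hn' : 0 < √(n : ℝ) := Real.sqrt_pos.2 (by exact_mod_cast hn)
  have hxc : |c| / 2 ≤ |x| := by
    have h := abs_sub_abs_le_abs_sub c x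
    rw [abs_sub_comm] at h
    linarith
  have hx0 : 0 < |x| := hc2.trans_le hxc
  refine ⟨abs_pos.1 hx0, ?_⟩
  have hw : A ≤ |x| ^ γ₂ := Real.rpow_le_rpow hc2.le hxc hγ₂
  have hv : (|x| ^ γ₁)⁻¹ ≤ B :=
    inv_anti₀ (Real.rpow_pos_of_pos hc2 _) (Real.rpow_le_rpow hc2.le hxc hγ₁)
  have e1 := mul_le_mul_of_nonneg_left hw (heta n)
  have e2 := mul_le_mul_of_nonneg_left hv (hlam n)
  rw [div_le_div_iff₀ hApos hl] at hel
  rw [div_lt_div_iff₀ hApos hn'] at hen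
  linarith

/-- On an inactive coordinate the adaptive penalty eventually dominates, uniformly over initial
estimates of order `O(1/√m)`. -/
lemma eventually_adaptive_weight_dominates {m : ℕ → ℕ} (hm : ∀ᶠ n in atTop, 0 < m n)
    {γ₁ γ₂ : ℝ} (hγ₁ : 0 ≤ γ₁) (hγ₂ : 0 ≤ γ₂) {lam eta : ℕ → ℝ}
    (hlam : ∀ᶠ n in atTop, 0 < lam n) (heta : ∀ n, 0 ≤ eta n)
    (h1 : Tendsto (fun n : ℕ => √((m n : ℝ) ^ γ₁ / (n : ℝ)) * lam n) atTop atTop)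
    (h4 : Tendsto (fun n : ℕ => eta n / (√((m n : ℝ) ^ (γ₁ + γ₂)) * lam n)) atTop (𝓝 0))
    {K : ℝ} (hK : 0 < K) (M : ℝ) :
    ∀ᶠ n in atTop, ∀ x : ℝ, |x| ≤ K / √(m n : ℝ) → (x = 0 → γ₁ = 0) →
      2 * (M * √(n : ℝ)) < lam n * (|x| ^ γ₁)⁻¹ - eta n * |x| ^ γ₂ := by
  have hK1 : 0 < K ^ γ₁ := Real.rpow_pos_of_pos hK _
  have hK2 : 0 < K ^ γ₂ := Real.rpow_pos_of_pos hK _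
  -- Chosen so that the transfer term takes at most half of the adaptive one; the threshold `4 * M *
  -- K ^ γ₁` fits the score into the other half.
  have hthr : 0 < 1 / (2 * (K ^ γ₁ * K ^ γ₂)) := by positivity
  filter_upwards [hm, hlam, h1.eventually (eventually_gt_atTop (4 * M * K ^ γ₁)),
    h4.eventually (gt_mem_nhds hthr), eventually_gt_atTop 0] with n hmn hl hn1 hn4 hn x hx hx0
  have hm' : (0 : ℝ) < m n := by exact_mod_cast hmn
  have hn' : 0 < √(n : ℝ) := Real.sqrt_pos.2 (by exact_mod_cast hn)
  have hsm : 0 < √(m n : ℝ) := Real.sqrt_pos.2 hm'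
  have hcomm : ∀ γ : ℝ, √((m n : ℝ) ^ γ) = √(m n : ℝ) ^ γ := fun γ => by
    rw [Real.sqrt_eq_rpow, Real.sqrt_eq_rpow, ← Real.rpow_mul hm'.le, ← Real.rpow_mul hm'.le,
      mul_comm]
  set s := √(m n : ℝ) ^ γ₁ with hs
  set t := √(m n : ℝ) ^ γ₂ with ht
  have hspos : 0 < s := Real.rpow_pos_of_pos hsm _
  have htpos : 0 < t := Real.rpow_pos_of_pos hsm _
  rw [Real.sqrt_div (by positivity), hcomm, ← hs, div_mul_eq_mul_div,
    lt_div_iff₀ hn'] at hn1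
  rw [hcomm, Real.rpow_add hsm, ← hs, ← ht, div_lt_div_iff₀ (by positivity) (by positivity),
    one_mul] at hn4
  have hxpos : 0 < |x| ^ γ₁ := by
    rcases eq_or_ne x 0 with rfl | h
    · simp [hx0 rfl]
    · exact Real.rpow_pos_of_pos (abs_pos.2 h) _
  have hv : s / K ^ γ₁ ≤ (|x| ^ γ₁)⁻¹ := by
    rw [← inv_div, hs, ← Real.div_rpow hK.le hsm.le]
    exact inv_anti₀ hxpos (Real.rpow_le_rpow (abs_nonneg _) hx hγ₁)
  have hw : |x| ^ γ₂ ≤ K ^ γ₂ / t := by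
    rw [ht, ← Real.div_rpow hK.le hsm.le]
    exact Real.rpow_le_rpow (abs_nonneg _) hx hγ₂
  have e1 := mul_le_mul_of_nonneg_left hv hl.le
  have e2 := mul_le_mul_of_nonneg_left hw (heta n)
  have e3 : eta n * (K ^ γ₂ / t) ≤ lam n * (s / K ^ γ₁) / 2 := by
    rw [← mul_div_assoc, ← mul_div_assoc, div_div, div_le_div_iff₀ htpos (by positivity)]
    nlinarith
  have e4 : 4 * M * √(n : ℝ) < lam n * (s / K ^ γ₁) := by
    rw [← mul_div_assoc, lt_div_iff₀ hK1]
    linarith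
  linarith

lemma exists_eventually_abs_gram_le {p : ℕ} {X : (n : ℕ) → Matrix (Fin n) (Fin p) ℝ}
    {C : Matrix (Fin p) (Fin p) ℝ}
    (hXC : Tendsto (fun n : ℕ => (1 / (n : ℝ)) • ((X n)ᵀ * X n)) atTop (𝓝 C)) :
    ∃ G : ℝ, 0 ≤ G ∧ ∀ᶠ n : ℕ in atTop, ∀ j k, |((X n)ᵀ * X n) j k| ≤ G * n := by
  refine ⟨∑ j, ∑ k, |C j k| + 1, by positivity, ?_⟩
  have hentry : ∀ j k, ∀ᶠ n : ℕ in atTop,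
      |(1 / (n : ℝ)) * ((X n)ᵀ * X n) j k| < |C j k| + 1 := fun j k => by
    have := ((tendsto_pi_nhds.1 (tendsto_pi_nhds.1 hXC j) k).abs).eventually
      (gt_mem_nhds (lt_add_one |C j k|))
    simpa using this
  filter_upwards [eventually_all.2 fun j => eventually_all.2 (hentry j), eventually_gt_atTop 0]
    with n hn hn0 j k
  have hn' : (0 : ℝ) < n := by exact_mod_cast hn0
  have hC : |C j k| ≤ ∑ j, ∑ k, |C j k| :=
    (Finset.single_le_sum (f := fun k => |C j k|) (fun _ _ => abs_nonneg _)
      (Finset.mem_univ k)).trans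
    (Finset.single_le_sum (f := fun j => ∑ k, |C j k|)
      (fun _ _ => Finset.sum_nonneg fun _ _ => abs_nonneg _) (Finset.mem_univ j))
  have h := hn j k
  rw [abs_mul, abs_of_pos (by positivity), one_div, inv_mul_lt_iff₀ hn'] at h
  nlinarith

/-- The score at a point at distance `O(1/√m)` of the truth is `O(√n)`. -/
lemma exists_eventually_abs_score_le {p : ℕ} {X : (n : ℕ) → Matrix (Fin n) (Fin p) ℝ}
    {C : Matrix (Fin p) (Fin p) ℝ}
    (hXC : Tendsto (fun n : ℕ => (1 / (n : ℝ)) • ((X n)ᵀ * X n)) atTop (𝓝 C))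
    {m : ℕ → ℕ} (hm : ∀ᶠ n in atTop, 0 < m n) {r : ℝ}
    (hr : Tendsto (fun n : ℕ => (n : ℝ) / (m n : ℝ)) atTop (𝓝 r)) {K : ℝ} (hK : 0 ≤ K) :
    ∃ M : ℝ, ∀ᶠ n in atTop, ∀ (e : Fin n → ℝ) (d : Fin p → ℝ),
      (∀ j, |((X n)ᵀ *ᵥ e) j| ≤ K * √(n : ℝ)) → (∀ j, |d j| ≤ K / √(m n : ℝ)) →
      ∀ j, |((X n)ᵀ *ᵥ (e - X n *ᵥ d)) j| ≤ M * √(n : ℝ) := by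
  obtain ⟨G, hG, hgram⟩ := exists_eventually_abs_gram_le hXC
  refine ⟨K + p * G * K * √(|r| + 1), ?_⟩
  filter_upwards [hgram, hm, hr.eventually (gt_mem_nhds (lt_of_le_of_lt (le_abs_self r)
    (lt_add_one _)))] with n hgn hmn hrn e d he hd j
  have hm' : (0 : ℝ) < m n := by exact_mod_cast hmn
  have hsm : 0 < √(m n : ℝ) := Real.sqrt_pos.2 hm'
  have hsplit : ((X n)ᵀ *ᵥ (e - X n *ᵥ d)) j =
      ((X n)ᵀ *ᵥ e) j - ∑ k, ((X n)ᵀ * X n) j k * d k := by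
    rw [Matrix.mulVec_sub, Matrix.mulVec_mulVec]
    rfl
  have hsum : |∑ k, ((X n)ᵀ * X n) j k * d k| ≤ p * (G * n * (K / √(m n : ℝ))) := by
    refine (Finset.abs_sum_le_sum_abs _ _).trans ?_
    have : ∑ _k : Fin p, G * n * (K / √(m n : ℝ)) = p * (G * n * (K / √(m n : ℝ))) := by simp
    rw [← this]
    refine Finset.sum_le_sum fun k _ => ?_
    rw [abs_mul]
    exact mul_le_mul (hgn j k) (hd k) (abs_nonneg _) (by positivity)
  -- The shift `d` moves the score by order `n / √m = √(n / m) * √n`.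
  have hratio : (n : ℝ) / √(m n : ℝ) ≤ √(|r| + 1) * √(n : ℝ) := by
    have : (n : ℝ) / √(m n : ℝ) = √((n : ℝ) / m n) * √(n : ℝ) := by
      rw [Real.sqrt_div (by positivity), div_mul_eq_mul_div, Real.mul_self_sqrt (by positivity)]
    rw [this]
    exact mul_le_mul_of_nonneg_right (Real.sqrt_le_sqrt hrn.le) (Real.sqrt_nonneg _)
  have h3 : (p : ℝ) * (G * n * (K / √(m n : ℝ))) ≤ p * G * K * (√(|r| + 1) * √(n : ℝ)) := by
    have : (p : ℝ) * (G * n * (K / √(m n : ℝ))) = p * G * K * (n / √(m n : ℝ)) := by ring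
    rw [this]
    exact mul_le_mul_of_nonneg_left hratio (by positivity)
  rw [hsplit]
  have h4 := abs_sub (((X n)ᵀ *ᵥ e) j) (∑ k, ((X n)ᵀ * X n) j k * d k)
  have h5 := he j
  linarith

/-! ### Tightness and the high-probability reduction. -/

/-- A sequence converging in distribution is asymptotically tight. -/
lemma MeasureTheory.TendstoInDistribution.exists_eventually_measure_norm_gt_le
    {Ω Ω' E : Type*} [MeasurableSpace Ω] [MeasurableSpace Ω'] [NormedAddCommGroup E]
    [MeasurableSpace E] [BorelSpace E]
    {P : Measure Ω} [IsProbabilityMeasure P] {P' : Measure Ω'} [IsProbabilityMeasure P']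
    {T : ℕ → Ω → E} {Z : Ω' → E} (h : TendstoInDistribution T atTop Z (fun _ => P) P')
    {δ : ℝ≥0∞} (hδ : 0 < δ) :
    ∃ K₀ : ℝ, ∀ K ≥ K₀, ∀ᶠ n in atTop, P {ω | K < ‖T n ω‖} ≤ δ := by
  have hanti : Antitone fun k : ℕ => {x : E | (k : ℝ) ≤ ‖x‖} := fun a b hab x hx =>
    le_trans (by exact_mod_cast hab) (show (b : ℝ) ≤ ‖x‖ from hx)
  have hclosed : ∀ k : ℕ, IsClosed {x : E | (k : ℝ) ≤ ‖x‖} := fun k =>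
    isClosed_le continuous_const continuous_norm
  have hempty : ⋂ k : ℕ, {x : E | (k : ℝ) ≤ ‖x‖} = ∅ := by
    ext x
    obtain ⟨k, hk⟩ := exists_nat_gt ‖x‖
    simp only [Set.mem_iInter, Set.mem_ofPred_eq, Set.mem_empty_iff_false, iff_false, not_forall,
      not_le]
    exact ⟨k, hk⟩
  have := Measure.isProbabilityMeasure_map h.aemeasurable_limit
  have hlim := tendsto_measure_iInter_atTop (μ := P'.map Z)
    (fun k => (hclosed k).measurableSet.nullMeasurableSet) hanti ⟨0, measure_ne_top _ _⟩
  rw [hempty, measure_empty] at hlim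
  obtain ⟨k, hk⟩ := (hlim.eventually (gt_mem_nhds hδ)).exists
  -- Portmanteau for a closed norm tail that has small mass under the limit law.
  have hsup := ProbabilityMeasure.limsup_measure_closed_le_of_tendsto h.tendsto (hclosed k)
  have hev := eventually_lt_of_limsup_lt (lt_of_le_of_lt hsup hk)
  refine ⟨k, fun K hK => hev.mono fun n hn => ?_⟩
  refine le_trans (measure_mono fun ω hω => ?_)
    (le_trans (Measure.le_map_apply (h.forall_aemeasurable n) _) hn.le)
  exact le_trans hK (le_of_lt hω)

/-- Chebyshev's inequality for a linear combination of i.i.d. centred Gaussian variables. -/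
lemma measure_lt_abs_sum_mul_gaussian_le {Ω ι : Type*} [MeasurableSpace Ω] [Fintype ι]
    {P : Measure Ω} [IsProbabilityMeasure P] {σ : ℝ≥0} {ε : ι → Ω → ℝ}
    (hlaw : ∀ i, HasLaw (ε i) (gaussianReal 0 (σ ^ 2)) P) (hindep : iIndepFun ε P)
    (a : ι → ℝ) {t : ℝ} (ht : 0 < t) :
    P {ω | t < |∑ i, a i * ε i ω|} ≤ ENNReal.ofReal ((σ : ℝ) ^ 2 * (∑ i, a i ^ 2) / t ^ 2) := by
  have hLp : ∀ i, MemLp (ε i) 2 P := fun i => by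
    have := (memLp_id_gaussianReal (μ := 0) (v := σ ^ 2) 2)
    rw [← (hlaw i).map_eq] at this
    exact (memLp_map_measure_iff aestronglyMeasurable_id (hlaw i).aemeasurable).1 this
  have hLp' : ∀ i, MemLp (fun ω => a i * ε i ω) 2 P := fun i => (hLp i).const_mul _
  have hmean : ∀ i, ∫ ω, ε i ω ∂P = 0 := fun i => by
    rw [(hlaw i).integral_eq, integral_id_gaussianReal]
  have hvar : ∀ i, variance (ε i) P = (σ : ℝ) ^ 2 := fun i => by
    rw [(hlaw i).variance_eq, variance_id_gaussianReal]; simp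
  have hsumLp : MemLp (fun ω => ∑ i, a i * ε i ω) 2 P := memLp_finsetSum _ fun i _ => hLp' i
  have hsum0 : ∫ ω, ∑ i, a i * ε i ω ∂P = 0 := by
    rw [integral_finsetSum _ fun i _ => (hLp' i).integrable (by norm_num)]
    simp [integral_const_mul, hmean]
  have hsumvar : variance (fun ω => ∑ i, a i * ε i ω) P = (σ : ℝ) ^ 2 * ∑ i, a i ^ 2 := by
    have := IndepFun.variance_sum (μ := P) (X := fun i ω => a i * ε i ω) (s := Finset.univ)
      (fun i _ => hLp' i) (fun i _ j _ hij => (hindep.indepFun hij).comp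
        (φ := fun x => a i * x) (ψ := fun x => a j * x) (by fun_prop) (by fun_prop))
    have heq : (fun ω => ∑ i, a i * ε i ω) = ∑ i, fun ω => a i * ε i ω := by
      ext ω; simp
    rw [heq, this, Finset.mul_sum]
    refine Finset.sum_congr rfl fun i _ => ?_
    rw [variance_const_mul, hvar]; ring
  have := meas_ge_le_variance_div_sq hsumLp ht
  rw [hsumvar, hsum0] at this
  refine le_trans (measure_mono fun ω hω => ?_) this
  simpa using le_of_lt hω

/-- With an initial estimate at distance `O(1/√m)` of the truth and a score of order `√n`, the
Adaptive Transfer Lasso eventually keeps the initial estimate on the active set and vanishes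
elsewhere. -/
theorem eventually_isAdaptiveTransferLasso_eq_indicator {p : ℕ}
    {X : (n : ℕ) → Matrix (Fin n) (Fin p) ℝ} {βstar : Fin p → ℝ}
    {C : Matrix (Fin p) (Fin p) ℝ}
    (hXC : Tendsto (fun n : ℕ => (1 / (n : ℝ)) • ((X n)ᵀ * X n)) atTop (𝓝 C))
    {m : ℕ → ℕ} (hm : ∀ᶠ n in atTop, 0 < m n)
    {r₀ : ℝ} (hr₀ : Tendsto (fun n : ℕ => (n : ℝ) / (m n : ℝ)) atTop (𝓝 r₀))
    {γ₁ γ₂ : ℝ} (hγ₁ : 0 ≤ γ₁) (hγ₂ : 0 ≤ γ₂)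
    {lam eta : ℕ → ℝ} (hlam : ∀ n, 0 ≤ lam n) (heta : ∀ n, 0 ≤ eta n)
    (h1 : Tendsto (fun n : ℕ => √((m n : ℝ) ^ γ₁ / (n : ℝ)) * lam n) atTop atTop)
    (h2 : Tendsto (fun n : ℕ => eta n / √(n : ℝ)) atTop atTop)
    (h3 : Tendsto (fun n : ℕ => eta n / lam n) atTop atTop)
    (h4 : Tendsto (fun n : ℕ => eta n / (√((m n : ℝ) ^ (γ₁ + γ₂)) * lam n)) atTop (𝓝 0))
    {K : ℝ} (hK : 0 < K) :
    ∀ᶠ n in atTop, ∀ (e : Fin n → ℝ) (b β : Fin p → ℝ),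
      ‖√(m n : ℝ) • (b - βstar)‖ ≤ K → (∀ j, |((X n)ᵀ *ᵥ e) j| ≤ K * √(n : ℝ)) →
      IsAdaptiveTransferLasso (X n) (linearResponse (X n) βstar e) (lam n) (eta n) γ₁ γ₂ b β →
      β = (Function.support βstar).indicator b ∧ ∀ j ∈ Function.support βstar, b j ≠ 0 := by
  have hmtop := tendsto_natCast_atTop_of_tendsto_div hm hr₀
  have hlpos := eventually_pos_of_tendsto_div_atTop hlam h3
  obtain ⟨M, hM⟩ := exists_eventually_abs_score_le hXC hm hr₀ hK.le
  have hact : ∀ᶠ n in atTop, ∀ j ∈ Function.support βstar, ∀ x : ℝ,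
      |x - βstar j| ≤ K / √(m n : ℝ) →
      x ≠ 0 ∧ 2 * (M * √(n : ℝ)) < eta n * |x| ^ γ₂ - lam n * (|x| ^ γ₁)⁻¹ := by
    refine eventually_all.2 fun j => ?_
    by_cases hj : j ∈ Function.support βstar
    · filter_upwards [eventually_transfer_weight_dominates hmtop hγ₁ hγ₂ hlam heta h2 h3 hj K M]
        with n hn _ using hn
    · exact Eventually.of_forall fun n hj' => absurd hj' hj
  filter_upwards [hM, hact, hm, hlpos, eventually_gt_atTop 0,
    eventually_adaptive_weight_dominates hm hγ₁ hγ₂ hlpos heta h1 h4 hK M]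
    with n hMn hactn hmn hl hn hinact e b β hb he hβ
  have hsm : 0 < √(m n : ℝ) := Real.sqrt_pos.2 (by exact_mod_cast hmn)
  have hbj : ∀ j, |b j - βstar j| ≤ K / √(m n : ℝ) := fun j => by
    have := (norm_le_pi_norm _ j).trans hb
    rw [Pi.smul_apply, norm_smul, Real.norm_of_nonneg hsm.le, Real.norm_eq_abs,
      Pi.sub_apply] at this
    rwa [le_div_iff₀' hsm]
  set S := Function.support βstar with hS
  set d := S.indicator b - βstar with hd
  have hout : ∀ j ∉ S, βstar j = 0 := fun j hj => Function.notMem_support.1 hj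
  have hdj : ∀ j, |d j| ≤ K / √(m n : ℝ) := fun j => by
    by_cases hj : j ∈ S
    · simpa [hd, hj] using hbj j
    · simp only [hd, Pi.sub_apply, Set.indicator_of_notMem hj, hout j hj, sub_self, abs_zero]
      positivity
  have hres : linearResponse (X n) βstar e - X n *ᵥ S.indicator b = e - X n *ᵥ d := by
    rw [hd, Matrix.mulVec_sub, linearResponse]
    abel
  have hscore := hMn e d he hdj
  have hbS : ∀ j ∈ S, b j ≠ 0 := fun j hj => (hactn j hj (b j) (hbj j)).1
  refine ⟨hβ.eq_indicator hn hl (heta n) hγ₁ hγ₂ hbS (fun j hj => ?_) fun j hj hj0 => ?_, hbS⟩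
  · rw [hres]
    exact lt_of_le_of_lt (mul_le_mul_of_nonneg_left (hscore j) zero_le_two)
      (hactn j hj (b j) (hbj j)).2
  · rw [hres]
    refine lt_of_le_of_lt (mul_le_mul_of_nonneg_left (hscore j) zero_le_two)
      (hinact (b j) ?_ hj0)
    simpa [hout j hj] using hbj j

/-- The noise score `Xᵀ ε / √n` is asymptotically tight. -/
lemma exists_eventually_measure_score_gt_le {Ω : Type*} [MeasurableSpace Ω] {P : Measure Ω}
    [IsProbabilityMeasure P] {p : ℕ} {X : (n : ℕ) → Matrix (Fin n) (Fin p) ℝ} {σ : ℝ≥0}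
    {ε : (n : ℕ) → Fin n → Ω → ℝ}
    (hε_law : ∀ n i, HasLaw (ε n i) (gaussianReal 0 (σ ^ 2)) P)
    (hε_indep : ∀ n, iIndepFun (ε n) P) {C : Matrix (Fin p) (Fin p) ℝ}
    (hXC : Tendsto (fun n : ℕ => (1 / (n : ℝ)) • ((X n)ᵀ * X n)) atTop (𝓝 C))
    {δ : ℝ≥0∞} (hδ : 0 < δ) :
    ∃ K₀ : ℝ, ∀ K ≥ K₀, ∀ᶠ n : ℕ in atTop, ∀ j,
      P {ω | K * √(n : ℝ) < |((X n)ᵀ *ᵥ fun i => ε n i ω) j|} ≤ δ := by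
  obtain ⟨G, hG, hgram⟩ := exists_eventually_abs_gram_le hXC
  -- Chebyshev bound: variance at most `σ² * G * n` against the squared level `K² * n`.
  have hlim : Tendsto (fun K : ℝ => ENNReal.ofReal ((σ : ℝ) ^ 2 * G / K ^ 2)) atTop (𝓝 0) := by
    rw [← ENNReal.ofReal_zero]
    exact ENNReal.tendsto_ofReal
      ((tendsto_pow_atTop two_ne_zero).const_div_atTop ((σ : ℝ) ^ 2 * G))
  obtain ⟨K₀, hK₀⟩ := eventually_atTop.1
    ((hlim.eventually (gt_mem_nhds hδ)).and (eventually_gt_atTop 0))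
  refine ⟨K₀, fun K hK => ?_⟩
  obtain ⟨hKδ, hKpos⟩ := hK₀ K hK
  filter_upwards [hgram, eventually_gt_atTop 0] with n hgn hn j
  have hn' : (0 : ℝ) < n := by exact_mod_cast hn
  have hsn : 0 < √(n : ℝ) := Real.sqrt_pos.2 hn'
  have hcheb := measure_lt_abs_sum_mul_gaussian_le (hε_law n) (hε_indep n)
    (fun i => X n i j) (mul_pos hKpos hsn)
  refine hcheb.trans (le_trans (ENNReal.ofReal_le_ofReal ?_) hKδ.le)
  have hdiag : ∑ i, X n i j ^ 2 ≤ G * n := by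
    have := (le_abs_self _).trans (hgn j j)
    simpa [Matrix.mul_apply, sq] using this
  rw [mul_pow, Real.sq_sqrt hn'.le, div_le_div_iff₀ (by positivity) (by positivity)]
  have := mul_le_mul_of_nonneg_left hdiag (show 0 ≤ (σ : ℝ) ^ 2 * K ^ 2 by positivity)
  linarith

/-- If the complements of events have probability tending to `0`, then any larger events have
probability tending to `1`; no measurability is needed. -/
lemma tendsto_measure_one_of_compl {Ω : Type*} [MeasurableSpace Ω] {P : Measure Ω}
    [IsProbabilityMeasure P] {A B : ℕ → Set Ω} (hAB : ∀ n, A n ⊆ B n)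
    (hA : Tendsto (fun n => P (A n)ᶜ) atTop (𝓝 0)) : Tendsto (fun n => P (B n)) atTop (𝓝 1) := by
  have hlow : Tendsto (fun n => 1 - P (A n)ᶜ) atTop (𝓝 1) := by
    simpa using ENNReal.Tendsto.sub tendsto_const_nhds hA (Or.inl ENNReal.one_ne_top)
  refine tendsto_of_tendsto_of_tendsto_of_le_of_le hlow tendsto_const_nhds (fun n => ?_)
    fun n => prob_le_one
  refine tsub_le_iff_right.2 ?_
  calc 1 = P Set.univ := measure_univ.symm
    _ = P (A n ∪ (A n)ᶜ) := by rw [Set.union_compl_self]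
    _ ≤ P (A n) + P (A n)ᶜ := measure_union_le _ _
    _ ≤ P (B n) + P (A n)ᶜ := by gcongr; exact hAB n

/-! ### Conclusion. -/

theorem mainTheorem2
    {Ω : Type*} [MeasurableSpace Ω] (P : Measure Ω) [IsProbabilityMeasure P]
    {p : ℕ}
    -- linear model: design matrices, true parameter, i.i.d. Gaussian noise
    (X : (n : ℕ) → Matrix (Fin n) (Fin p) ℝ)
    (βstar : Fin p → ℝ) (σ : ℝ≥0)
    (ε : (n : ℕ) → Fin n → Ω → ℝ)
    (hε_law : ∀ n i, HasLaw (ε n i) (gaussianReal 0 (σ ^ 2)) P)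
    (hε_indep : ∀ n, iIndepFun (ε n) P)
    -- assumptions on the design
    (C : Matrix (Fin p) (Fin p) ℝ) (hC : C.PosDef)
    (hXC : Tendsto (fun n : ℕ => (1 / (n : ℝ)) • ((X n)ᵀ * X n)) atTop (𝓝 C))
    (hXmax : Tendsto (fun n : ℕ => (1 / (n : ℝ)) * ⨆ i, ∑ j, X n i j ^ 2) atTop (𝓝 0))
    -- source sample size
    (m : ℕ → ℕ) (hm : ∀ᶠ n in atTop, 0 < m n)
    (r₀ : ℝ) (hr₀ : Tendsto (fun n : ℕ => (n : ℝ) / (m n : ℝ)) atTop (𝓝 r₀))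
    -- initial estimator, independent of the target data,
    -- with `√m (β̃ - β*)` converging in distribution to some random vector `Z`
    (βtilde : ℕ → Ω → Fin p → ℝ) (hβtilde : ∀ n, AEMeasurable (βtilde n) P)
    (hindep : ∀ n, IndepFun (βtilde n) (fun ω i => ε n i ω) P)
    {Ω' : Type*} [MeasurableSpace Ω'] (P' : Measure Ω') [IsProbabilityMeasure P']
    (Z : Ω' → Fin p → ℝ)
    (hZ : TendstoInDistribution
      (fun n ω => √(m n : ℝ) • (βtilde n ω - βstar)) atTop Z (fun _ => P) P')
    -- hyperparameters
    (γ₁ γ₂ : ℝ) (hγ₁ : 0 ≤ γ₁) (hγ₂ : 0 ≤ γ₂)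
    (lam eta : ℕ → ℝ) (hlam : ∀ n, 0 ≤ lam n) (heta : ∀ n, 0 ≤ eta n)
    -- regime (ii)
    (h1 : Tendsto (fun n : ℕ => √((m n : ℝ) ^ γ₁ / (n : ℝ)) * lam n) atTop atTop)
    (h2 : Tendsto (fun n : ℕ => eta n / √(n : ℝ)) atTop atTop)
    (h3 : Tendsto (fun n : ℕ => eta n / lam n) atTop atTop)
    (h4 : Tendsto (fun n : ℕ => eta n / (√((m n : ℝ) ^ (γ₁ + γ₂)) * lam n)) atTop (𝓝 0))
    -- the Adaptive Transfer Lasso estimator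
    (βhat : ℕ → Ω → Fin p → ℝ) (hβhat : ∀ n, AEMeasurable (βhat n) P)
    (hmin : ∀ n, ∀ᵐ ω ∂P, IsAdaptiveTransferLasso (X n)
      (linearResponse (X n) βstar (fun i => ε n i ω))
      (lam n) (eta n) γ₁ γ₂ (βtilde n ω) (βhat n ω)) :
    -- `√m`-consistency, with the limit: `Z` on the active set, `0` off it
    TendstoInDistribution
      (fun n ω => √(m n : ℝ) • (βhat n ω - βstar)) atTop
      (fun ω' => (Function.support βstar).indicator (Z ω')) (fun _ => P) P' ∧
    -- consistent active variable selection
    Tendsto (fun n => P {ω | Function.support (βhat n ω) = Function.support βstar})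
      atTop (𝓝 1) ∧
    -- consistent invariant variable selection
    Tendsto (fun n => P {ω | ∀ j ∈ Function.support βstar, βhat n ω j = βtilde n ω j})
      atTop (𝓝 1) := by
  set S := Function.support βstar with hS
  -- The nonvanishing clause makes the support of the indicator all of `S`.
  set A : ℕ → Set Ω := fun n => {ω | βhat n ω = S.indicator (βtilde n ω) ∧
    ∀ j ∈ S, βtilde n ω j ≠ 0} with hA
  have hAc : Tendsto (fun n => P (A n)ᶜ) atTop (𝓝 0) := by
    refine ENNReal.tendsto_nhds_zero.2 fun δ hδ => ?_
    -- One share for the initial estimator and one for each of the `p` score coordinates.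
    have hδ' : 0 < δ / (p + 1) :=
      ENNReal.div_pos hδ.ne' (ENNReal.add_ne_top.2 ⟨ENNReal.natCast_ne_top p, ENNReal.one_ne_top⟩)
    obtain ⟨K₁, hK₁⟩ := hZ.exists_eventually_measure_norm_gt_le hδ'
    obtain ⟨K₂, hK₂⟩ := exists_eventually_measure_score_gt_le hε_law hε_indep hXC hδ'
    set K := max 1 (max K₁ K₂) with hKdef
    have hKpos : 0 < K := lt_of_lt_of_le one_pos (le_max_left _ _)
    filter_upwards [hK₁ K ((le_max_left _ _).trans (le_max_right _ _)),
      hK₂ K ((le_max_right _ _).trans (le_max_right _ _)),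
      eventually_isAdaptiveTransferLasso_eq_indicator (βstar := βstar) hXC hm hr₀ hγ₁ hγ₂ hlam
        heta h1 h2 h3 h4 hKpos] with n hn₁ hn₂ hdet
    have hsub : (A n)ᶜ ≤ᵐ[P] ({ω | K < ‖√(m n : ℝ) • (βtilde n ω - βstar)‖} ∪
        ⋃ j, {ω | K * √(n : ℝ) < |((X n)ᵀ *ᵥ fun i => ε n i ω) j|} : Set Ω) := by
      refine (hmin n).mono fun ω hω hωA => ?_
      by_contra hcon
      change ω ∉ (_ ∪ _ : Set Ω) at hcon
      simp only [Set.mem_union, Set.mem_iUnion, Set.mem_ofPred_eq, not_or, not_exists,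
        not_lt] at hcon
      exact hωA (hdet _ _ _ hcon.1 hcon.2 hω)
    calc P (A n)ᶜ ≤ _ := measure_mono_ae hsub
      _ ≤ δ / (p + 1) + ∑ _j : Fin p, δ / (p + 1) := by
          refine (measure_union_le _ _).trans (add_le_add hn₁ ?_)
          exact (measure_iUnion_fintype_le _ _).trans (Finset.sum_le_sum fun j _ => hn₂ j)
      _ = (p + 1) * (δ / (p + 1)) := by
          rw [Finset.sum_const, Finset.card_univ, Fintype.card_fin, nsmul_eq_mul]; ring
      _ ≤ δ := ENNReal.mul_div_le
  refine ⟨?_, tendsto_measure_one_of_compl (fun n ω hω => ?_) hAc,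
    tendsto_measure_one_of_compl (fun n ω hω j hj => ?_) hAc⟩
  · have hcont : Continuous fun x : Fin p → ℝ => S.indicator x := by
      refine continuous_pi fun j => ?_
      by_cases hj : j ∈ S
      · simpa [hj] using continuous_apply j
      · simpa [hj] using continuous_const
    have hcomp := hZ.continuous_comp hcont
    -- Slutsky: on `A n` the rescaled error is exactly the continuous image `S.indicator` of that of
    -- `βtilde`, so their difference tends to `0` in probability.
    refine tendstoInDistribution_of_tendstoInMeasure_sub _ _ hcomp ?_ fun n =>
      (((hβhat n).sub_const βstar).const_smul √(m n : ℝ) :)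
    intro a ha
    refine tendsto_of_tendsto_of_tendsto_of_le_of_le tendsto_const_nhds hAc
      (fun _ => zero_le) fun n => measure_mono fun ω hω hωA => ?_
    have hzero : √(m n : ℝ) • (βhat n ω - βstar) =
        S.indicator (√(m n : ℝ) • (βtilde n ω - βstar)) := by
      rw [hωA.1]
      ext j
      by_cases hj : j ∈ S
      · simp [hj]
      · simp [hj, Function.notMem_support.1 hj]
    rw [Set.mem_ofPred_eq] at hω
    simp [hzero, ha.ne'] at hω
  · change Function.support (βhat n ω) = S
    rw [hω.1]
    ext j
    by_cases hj : j ∈ S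
    · simp [hj, hω.2 j hj]
    · simp [hj]
  · rw [hω.1, Set.indicator_of_mem hj]
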